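/- Let $p$ be an odd prime with $1/p+1/p<1/2$, and let $q$ be a power of $p$. Let $M$ be a regular map (a cellular embedding of a connected graph in a surface whose automorphism group acts regularly on the flags) of type $(p,p)$, that is, every vertex has valency $p$ and every face has length $p$, and suppose that its automorphism group $G$ is isomorphic to $PSL(2,q)$ or $PGL(2,q)$. Then $M$ is not self-Petrie-dual, that is, $M$ is not isomorphic to its Petrie dual. Moreover, fix a flag of $M$ and let $X,Y,Z\in G$ be the automorphisms acting on this flag as the reflection in the edge bisector, the reflection across the edge, and the reflection in the angle bisector at the vertex, respectively. Identify $G$ in any way with the subgroup $PSL(2,q)$ of $PGL(2,q)$ or with $PGL(2,q)$ itself, and let $(A,\phi)\in P\Gamma L(2,q)=PGL(2,q)\rtimes \mathrm{Aut}(GF(q))$ act by $T\mapsto A\,\phi(T)\,A^{-1}$. Then no element of $P\Gamma L(2,q)$ fixes both $Y$ and $Z$ while exchanging $X$ with $XY$. -/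

import Mathlib

open scoped MatrixGroups

/-- A map (cellular embedding of a connected graph in a surface without boundary), given by its
set `Ω` of flags. Each flag has exactly one neighbour across each of its three sides:
`r0` crosses the edge bisector (same edge and face, other vertex),
`r1` crosses the angle bisector at the vertex (same vertex and face, other edge),
`r2` crosses the edge (same vertex and edge, other face). -/
structure CombinatorialMap (Ω : Type*) where
  /-- reflection in the perpendicular bisector of the edge -/
  r0 : Equiv.Perm Ω
  /-- reflection in the bisector of the angle at the vertex -/
  r1 : Equiv.Perm Ω
  /-- reflection across the edge -/
  r2 : Equiv.Perm Ω
  r0_invol : ∀ a, r0 (r0 a) = a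
  r1_invol : ∀ a, r1 (r1 a) = a
  r2_invol : ∀ a, r2 (r2 a) = a
  r0_r2_comm : ∀ a, r0 (r2 a) = r2 (r0 a)
  r0_ne : ∀ a, r0 a ≠ a
  r1_ne : ∀ a, r1 a ≠ a
  r2_ne : ∀ a, r2 a ≠ a
  r0_r2_ne : ∀ a, r0 (r2 a) ≠ a
  nonempty : Nonempty Ω
  connected : ∀ a b, ∃ g ∈ Subgroup.closure ({r0, r1, r2} : Set (Equiv.Perm Ω)), g a = b

namespace CombinatorialMap

variable {Ω Ω' : Type*}

/-- Isomorphism of maps: a bijection between the flags that preserves all adjacencies. -/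
def IsIsomorphic (M : CombinatorialMap Ω) (N : CombinatorialMap Ω') : Prop :=
  ∃ f : Ω ≃ Ω', (∀ a, f (M.r0 a) = N.r0 (f a)) ∧ (∀ a, f (M.r1 a) = N.r1 (f a)) ∧
    ∀ a, f (M.r2 a) = N.r2 (f a)

/-- The automorphism group: all permutations of the flags that preserve all adjacencies. -/
def aut (M : CombinatorialMap Ω) : Subgroup (Equiv.Perm Ω) where
  carrier := {g | (∀ a, g (M.r0 a) = M.r0 (g a)) ∧ (∀ a, g (M.r1 a) = M.r1 (g a)) ∧
    ∀ a, g (M.r2 a) = M.r2 (g a)}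
  one_mem' := by simp
  mul_mem' := by
    rintro g h ⟨g0, g1, g2⟩ ⟨h0, h1, h2⟩
    refine ⟨fun a => ?_, fun a => ?_, fun a => ?_⟩ <;> simp [*]
  inv_mem' := by
    rintro g ⟨g0, g1, g2⟩
    refine ⟨fun a => ?_, fun a => ?_, fun a => ?_⟩ <;> rw [Equiv.Perm.inv_eq_iff_eq]
    · simp [g0]
    · simp [g1]
    · simp [g2]

/-- A map is regular if its automorphism group acts regularly on the flags. -/
def IsRegular (M : CombinatorialMap Ω) : Prop :=
  ∀ a b : Ω, ∃! g : M.aut, (g : Equiv.Perm Ω) a = b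

/-- Type `(k, l)`: every vertex has valency `k` and every face has length `l`. Starting at a flag,
`r1 * r2` steps to the next edge around its vertex, and `r0 * r1` to the next edge around its
face. -/
def HasType (M : CombinatorialMap Ω) (k l : ℕ) : Prop :=
  ∀ a : Ω, Function.minimalPeriod (M.r1 * M.r2) a = k ∧
    Function.minimalPeriod (M.r0 * M.r1) a = l

/-- The Petrie dual: the same flags, vertices and edges, where the boundary walks of the faces
cross over to the other side of each edge at its midpoint, so that `r0` is replaced by
`r0 * r2`. -/
def petrieDual (M : CombinatorialMap Ω) : CombinatorialMap Ω where
  r0 := M.r0 * M.r2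
  r1 := M.r1
  r2 := M.r2
  r0_invol a := by simp [M.r0_r2_comm, M.r0_invol, M.r2_invol]
  r1_invol := M.r1_invol
  r2_invol := M.r2_invol
  r0_r2_comm a := by simp [M.r0_r2_comm]
  r0_ne a := M.r0_r2_ne a
  r1_ne := M.r1_ne
  r2_ne := M.r2_ne
  r0_r2_ne a := by simpa [M.r2_invol] using M.r0_ne a
  nonempty := M.nonempty
  connected a b := by
    obtain ⟨g, hg, hab⟩ := M.connected a b
    refine ⟨g, ?_, hab⟩
    refine (Subgroup.closure_le _).2 ?_ hg
    have h2 : M.r2 ∈ Subgroup.closure ({M.r0 * M.r2, M.r1, M.r2} : Set (Equiv.Perm Ω)) :=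
      Subgroup.subset_closure (by simp)
    rintro x (rfl | rfl | rfl)
    · have h02 : M.r0 * M.r2 ∈
          Subgroup.closure ({M.r0 * M.r2, M.r1, M.r2} : Set (Equiv.Perm Ω)) :=
        Subgroup.subset_closure (by simp)
      simpa using Subgroup.mul_mem _ h02 (Subgroup.inv_mem _ h2)
    · exact Subgroup.subset_closure (by simp)
    · exact h2

/-- A map is self-Petrie-dual if it is isomorphic to its Petrie dual. -/
def IsSelfPetrieDual (M : CombinatorialMap Ω) : Prop :=
  M.IsIsomorphic M.petrieDual

/-- `X`, `Y`, `Z` are the automorphisms which act on the flag `a` as the local reflections in the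
edge bisector, across the edge, and in the angle bisector at the vertex, respectively. -/
def AreReflectionsAt (M : CombinatorialMap Ω) (a : Ω) (X Y Z : M.aut) : Prop :=
  (X : Equiv.Perm Ω) a = M.r0 a ∧ (Y : Equiv.Perm Ω) a = M.r2 a ∧ (Z : Equiv.Perm Ω) a = M.r1 a

end CombinatorialMap

/-- Field automorphisms act entrywise on `PGL(2, F)`. -/
def pglFieldAut (F : Type*) [Field F] : RingAut F →* MulAut PGL(2, F) where
  toFun s := MonoidHom.toMulEquiv
    (Matrix.ProjGenLinGroup.map (s : F →+* F)) (Matrix.ProjGenLinGroup.map (s.symm : F →+* F))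
    (by rw [← Matrix.ProjGenLinGroup.map_comp]; simp)
    (by rw [← Matrix.ProjGenLinGroup.map_comp]; simp)
  map_one' := by
    ext x
    exact DFunLike.congr_fun (Matrix.ProjGenLinGroup.map_id (n := Fin 2) (R := F)) x
  map_mul' s t := by
    ext x
    exact DFunLike.congr_fun
      (Matrix.ProjGenLinGroup.map_comp (n := Fin 2) (t : F →+* F) (s : F →+* F)) x

/-- `PΓL(2, F)`, the semidirect product of `PGL(2, F)` with the group of field automorphisms. When
`F` has `p ^ e` elements, the latter is cyclic of order `e`, generated by `x ↦ x ^ p`. -/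
abbrev PGammaL (F : Type*) [Field F] : Type _ :=
  SemidirectProduct PGL(2, F) (RingAut F) (pglFieldAut F)

/-- The action of `PΓL(2, F)` on `PGL(2, F)` by automorphisms:
`(A, s)` sends `T` to `A * s(T) * A⁻¹`. -/
def PGammaL.act {F : Type*} [Field F] : PGammaL F →* MulAut PGL(2, F) :=
  SemidirectProduct.lift MulAut.conj (pglFieldAut F) (by intro s; ext A T; simp)

theorem PGammaL.act_apply {F : Type*} [Field F] (g : PGammaL F) (T : PGL(2, F)) :
    PGammaL.act g T =
      g.left * Matrix.ProjGenLinGroup.map (g.right : F →+* F) T * g.left⁻¹ :=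
  rfl

/-! Lift `X`, `Y`, `Z` to matrices `x`, `y`, `z` over `F`. Since `X`, `Y`, `Z`, `XY` are
involutions, `x`, `y`, `z`, `xy` have trace zero, and `x`, `y`, `xy` are pairwise orthogonal for the
form tr(uv). Parseval's identity for `z` (`Matrix.four_mul_det_mul_det_mul_det`) ties the squared
traces of `xz`, `yz`, `xyz` to D = det x · det y · det z. An element whose `p`-th power is trivial
in characteristic `p` lifts to a matrix with tr² = 4 det. Type `(p, p)` gives this for `XZ` and
`YZ`; if it also held for `XYZ`, then 12 D = 4 D, impossible in odd characteristic. Both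
self-Petrie-duality and the forbidden element of `PΓL` would force `(XYZ)^p = 1`. -/

/-! ### Traces and determinants of 2 × 2 matrices -/

section TwoByTwo

variable {F : Type*} [Field F]

/-- A matrix whose `p`-th power is scalar in characteristic `p` has a double eigenvalue. -/
theorem Matrix.trace_sq_eq_four_mul_det_of_pow_char_eq_scalar {p : ℕ} [Fact p.Prime] [Finite F]
    [CharP F p] {A : Matrix (Fin 2) (Fin 2) F} {c : F} (h : A ^ p = Matrix.scalar (Fin 2) c) :
    A.trace ^ 2 = 4 * A.det := by
  -- Frobenius is bijective on a finite field, so `A ^ p - m ^ p` becomes `(A - m) ^ p`.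
  obtain ⟨m, rfl⟩ : ∃ m, m ^ p = c := by
    obtain ⟨m, hm⟩ := (Finite.injective_iff_surjective.1 (frobenius_inj F p)) c
    exact ⟨m, by rw [← hm, frobenius_def]⟩
  have hN : (A - Matrix.scalar (Fin 2) m) ^ p = 0 := by
    have hcomm : Commute A (Matrix.scalar (Fin 2) m) :=
      (Matrix.scalar_commute m (Commute.all m) A).symm
    rw [sub_pow_char_of_commute _ hcomm, h, map_pow, sub_self]
  have htr : (A - Matrix.scalar (Fin 2) m).trace = 0 :=
    (Matrix.isNilpotent_trace_of_isNilpotent ⟨p, hN⟩).eq_zero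
  have hdet : (A - Matrix.scalar (Fin 2) m).det = 0 := by
    refine pow_eq_zero_iff (Fact.out : p.Prime).ne_zero |>.1 ?_
    rw [← Matrix.det_pow, hN, Matrix.det_zero]
  simp [Matrix.trace_fin_two, Matrix.det_fin_two] at htr hdet ⊢
  linear_combination (A 0 0 + A 1 1 - 2 * m) * htr - 4 * hdet

/-- A non-scalar matrix whose square is scalar has trace zero. -/
theorem Matrix.trace_eq_zero_of_sq_eq_scalar {A : Matrix (Fin 2) (Fin 2) F} {c : F}
    (h : A ^ 2 = Matrix.scalar (Fin 2) c) (hA : A ∉ Set.range (Matrix.scalar (Fin 2))) :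
    A.trace = 0 := by
  by_contra ht
  rw [Matrix.trace_fin_two] at ht
  have h00 := congr_fun (congr_fun h 0) 0
  have h01 := congr_fun (congr_fun h 0) 1
  have h10 := congr_fun (congr_fun h 1) 0
  have h11 := congr_fun (congr_fun h 1) 1
  simp [pow_two, Matrix.mul_apply, Fin.sum_univ_two] at h00 h01 h10 h11
  -- Each off-diagonal entry of `A ^ 2` is that entry of `A` times the trace; the difference of the
  -- diagonal entries also has the trace as a factor.
  have e01 : A 0 1 = 0 := (mul_eq_zero.1 (by linear_combination h01)).resolve_left ht
  have e10 : A 1 0 = 0 := (mul_eq_zero.1 (by linear_combination h10)).resolve_left ht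
  have ed : A 0 0 - A 1 1 = 0 :=
    (mul_eq_zero.1 (by linear_combination h00 - h11)).resolve_left ht
  refine hA ⟨A 0 0, ?_⟩
  ext i j
  fin_cases i <;> fin_cases j <;> simp [e01, e10]
  linear_combination ed

/-- Parseval's identity in the space of trace zero matrices. -/
theorem Matrix.four_mul_det_mul_det_mul_det {x y z : Matrix (Fin 2) (Fin 2) F}
    (hx : x.trace = 0) (hy : y.trace = 0) (hz : z.trace = 0) (hxy : (x * y).trace = 0) :
    (x * z).trace ^ 2 * y.det + (y * z).trace ^ 2 * x.det + (x * y * z).trace ^ 2 =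
      4 * (x.det * y.det * z.det) := by
  simp only [Matrix.trace_fin_two, Matrix.det_fin_two, Matrix.mul_apply, Fin.sum_univ_two]
    at hx hy hz hxy ⊢
  have hx' : x 1 1 = -x 0 0 := by linear_combination hx
  have hy' : y 1 1 = -y 0 0 := by linear_combination hy
  have hz' : z 1 1 = -z 0 0 := by linear_combination hz
  rw [hx', hy'] at hxy
  rw [hx', hy', hz']
  grind

end TwoByTwo

/-! ### Involutions and unipotents in `PGL(2, F)` -/

namespace Matrix.ProjGenLinGroup

variable {F : Type*} [Field F]

theorem exists_val_eq_scalar_of_mk_eq_one {g : GL (Fin 2) F} (h : mk g = 1) :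
    ∃ c, (g : Matrix (Fin 2) (Fin 2) F) = Matrix.scalar (Fin 2) c := by
  rw [mk_eq_one, GeneralLinearGroup.mem_center_iff_val_mem_range_scalar] at h
  obtain ⟨c, hc⟩ := h
  exact ⟨c, hc.symm⟩

theorem trace_sq_eq_of_mk_pow_char_eq_one {p : ℕ} [Fact p.Prime] [Finite F] [CharP F p]
    {g : GL (Fin 2) F} (h : mk g ^ p = 1) : g.val.trace ^ 2 = 4 * g.val.det := by
  rw [← map_pow] at h
  obtain ⟨c, hc⟩ := exists_val_eq_scalar_of_mk_eq_one h
  exact Matrix.trace_sq_eq_four_mul_det_of_pow_char_eq_scalar (p := p) (c := c)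
    (by simpa using hc)

theorem trace_eq_zero_of_mk_sq_eq_one {g : GL (Fin 2) F} (h : mk g ^ 2 = 1) (hg : mk g ≠ 1) :
    g.val.trace = 0 := by
  rw [← map_pow] at h
  obtain ⟨c, hc⟩ := exists_val_eq_scalar_of_mk_eq_one h
  refine Matrix.trace_eq_zero_of_sq_eq_scalar (c := c) (by simpa using hc) fun hr => hg ?_
  rwa [mk_eq_one, GeneralLinearGroup.mem_center_iff_val_mem_range_scalar]

/-- For involutions `x`, `y`, `z` of `PGL(2, F)` such that `x * y` is an involution, the products
`x * z`, `y * z` and `x * y * z` are not all unipotent. -/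
theorem mul_mul_pow_char_ne_one {p : ℕ} [Fact p.Prime] [Finite F] [CharP F p] (hp : Odd p)
    {x y z : PGL(2, F)} (hx : x ^ 2 = 1) (hx1 : x ≠ 1) (hy : y ^ 2 = 1) (hy1 : y ≠ 1)
    (hz : z ^ 2 = 1) (hz1 : z ≠ 1) (hxy : (x * y) ^ 2 = 1) (hxy1 : x * y ≠ 1)
    (hxz : (x * z) ^ p = 1) (hyz : (y * z) ^ p = 1) : (x * y * z) ^ p ≠ 1 := by
  intro hxyz
  induction x using induction_on with | mk x =>
  induction y using induction_on with | mk y =>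
  induction z using induction_on with | mk z =>
  rw [← map_mul] at hxy hxy1 hxz hyz
  rw [← map_mul, ← map_mul] at hxyz
  have key := Matrix.four_mul_det_mul_det_mul_det (trace_eq_zero_of_mk_sq_eq_one hx hx1)
    (trace_eq_zero_of_mk_sq_eq_one hy hy1) (trace_eq_zero_of_mk_sq_eq_one hz hz1)
    (trace_eq_zero_of_mk_sq_eq_one hxy hxy1)
  have e1 := trace_sq_eq_of_mk_pow_char_eq_one hxz
  have e2 := trace_sq_eq_of_mk_pow_char_eq_one hyz
  have e3 := trace_sq_eq_of_mk_pow_char_eq_one hxyz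
  simp only [Units.val_mul, Matrix.det_mul] at e1 e2 e3
  rw [e1, e2, e3] at key
  have hdet (g : GL (Fin 2) F) : g.val.det ≠ 0 := g.det.ne_zero
  have h2 : (2 : F) ≠ 0 := Ring.two_ne_zero <| by
    rw [ringChar.eq F p]
    rintro rfl
    exact absurd hp (by decide)
  -- `key` now reads 4 D + 4 D + 4 D = 4 D.
  have h0 : (2 : F) ^ 3 * (x.val.det * y.val.det * z.val.det) = 0 := by
    linear_combination key
  exact mul_ne_zero (pow_ne_zero 3 h2)
    (mul_ne_zero (mul_ne_zero (hdet x) (hdet y)) (hdet z)) h0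

end Matrix.ProjGenLinGroup

/-! ### From flag permutations to automorphisms -/

namespace CombinatorialMap

variable {Ω Ω' : Type*} {M : CombinatorialMap Ω}

theorem IsRegular.aut_ext (hreg : M.IsRegular) {a : Ω} {g h : M.aut}
    (e : (g : Equiv.Perm Ω) a = (h : Equiv.Perm Ω) a) : g = h :=
  (hreg a _).unique e rfl

theorem commute_r0 (g : M.aut) : Commute (g : Equiv.Perm Ω) M.r0 :=
  Equiv.ext g.2.1

theorem commute_r1 (g : M.aut) : Commute (g : Equiv.Perm Ω) M.r1 :=
  Equiv.ext g.2.2.1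

theorem commute_r2 (g : M.aut) : Commute (g : Equiv.Perm Ω) M.r2 :=
  Equiv.ext g.2.2.2

theorem r0_mul_self : M.r0 * M.r0 = 1 := Equiv.ext M.r0_invol

theorem r1_mul_self : M.r1 * M.r1 = 1 := Equiv.ext M.r1_invol

theorem r2_mul_self : M.r2 * M.r2 = 1 := Equiv.ext M.r2_invol

/-- Agreement at the single flag `a` passes to powers because `T` commutes with `t`. -/
theorem coe_pow_apply {T : M.aut} {t : Equiv.Perm Ω} (h : Commute (T : Equiv.Perm Ω) t) {a : Ω}
    (e : (T : Equiv.Perm Ω) a = t a) (n : ℕ) :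
    ((T ^ n : M.aut) : Equiv.Perm Ω) a = (t ^ n) a := by
  induction n with
  | zero => simp
  | succ n ih =>
    rw [pow_succ', Subgroup.coe_mul, Equiv.Perm.mul_apply, ih, ← Equiv.Perm.mul_apply,
      (h.pow_right n).eq, Equiv.Perm.mul_apply, e, ← Equiv.Perm.mul_apply, ← pow_succ]

theorem IsRegular.pow_eq_one (hreg : M.IsRegular) {T : M.aut} {t : Equiv.Perm Ω}
    (h : Commute (T : Equiv.Perm Ω) t) {a : Ω} (e : (T : Equiv.Perm Ω) a = t a) {n : ℕ}
    (ht : (t ^ n) a = a) : T ^ n = 1 :=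
  hreg.aut_ext (a := a) (by rw [coe_pow_apply h e, ht]; rfl)

theorem IsRegular.exists_areReflectionsAt (hreg : M.IsRegular) (a : Ω) :
    ∃ X Y Z, M.AreReflectionsAt a X Y Z :=
  let ⟨X, hX, _⟩ := hreg a (M.r0 a)
  let ⟨Y, hY, _⟩ := hreg a (M.r2 a)
  let ⟨Z, hZ, _⟩ := hreg a (M.r1 a)
  ⟨X, Y, Z, hX, hY, hZ⟩

theorem HasType.r1_mul_r2_pow {k l : ℕ} (h : M.HasType k l) : (M.r1 * M.r2) ^ k = 1 := by
  ext a
  rw [← (h a).1, ← Equiv.Perm.iterate_eq_pow]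
  exact Function.iterate_minimalPeriod

theorem HasType.r0_mul_r1_pow {k l : ℕ} (h : M.HasType k l) : (M.r0 * M.r1) ^ l = 1 := by
  ext a
  rw [← (h a).2, ← Equiv.Perm.iterate_eq_pow]
  exact Function.iterate_minimalPeriod

theorem HasType.r1_mul_r0_pow {k l : ℕ} (h : M.HasType k l) : (M.r1 * M.r0) ^ l = 1 := by
  have : M.r1 * M.r0 = (M.r0 * M.r1)⁻¹ := by
    rw [mul_inv_rev, inv_eq_of_mul_eq_one_right M.r0_mul_self,
      inv_eq_of_mul_eq_one_right M.r1_mul_self]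
  rw [this, inv_pow, h.r0_mul_r1_pow, inv_one]

theorem HasType.petrie_pow {k l : ℕ} (h : M.petrieDual.HasType k l) :
    (M.r1 * (M.r2 * M.r0)) ^ l = 1 := by
  rw [show M.r2 * M.r0 = M.r0 * M.r2 from (Equiv.ext M.r0_r2_comm).symm]
  exact h.r1_mul_r0_pow

theorem HasType.of_isIsomorphic {N : CombinatorialMap Ω'} {k l : ℕ} (h : M.HasType k l)
    (hMN : M.IsIsomorphic N) : N.HasType k l := by
  obtain ⟨f, h0, h1, h2⟩ := hMN
  have key {t : Equiv.Perm Ω} {u : Equiv.Perm Ω'} (e : ∀ a, f (t a) = u (f a)) (a : Ω) :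
      Function.minimalPeriod u (f a) = Function.minimalPeriod t a := by
    refine Function.minimalPeriod_eq_minimalPeriod_iff.2 fun n => ?_
    have hn : f (t^[n] a) = u^[n] (f a) := Function.Semiconj.iterate_right e n a
    rw [Function.IsPeriodicPt, Function.IsFixedPt, ← hn, f.apply_eq_iff_eq]
    rfl
  intro b
  obtain ⟨a, rfl⟩ := f.surjective b
  exact ⟨(key (by simp [h1, h2]) a).trans (h a).1, (key (by simp [h0, h1]) a).trans (h a).2⟩

section Reflections

variable {a : Ω} {X Y Z : M.aut}

/-- The order reverses because `X` commutes with `r2`: X(Y a) = X(r2 a) = r2(X a). -/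
theorem AreReflectionsAt.mul_apply (h : M.AreReflectionsAt a X Y Z) :
    ((X * Y : M.aut) : Equiv.Perm Ω) a = (M.r2 * M.r0) a := by
  rw [Subgroup.coe_mul, Equiv.Perm.mul_apply, h.2.1, X.2.2.2, h.1]
  rfl

theorem AreReflectionsAt.mul_pow_face (h : M.AreReflectionsAt a X Y Z) (hreg : M.IsRegular)
    {k l : ℕ} (htype : M.HasType k l) : (X * Z) ^ l = 1 := by
  refine hreg.pow_eq_one (a := a) ((commute_r1 _).mul_right (commute_r0 _)) ?_
    (by rw [htype.r1_mul_r0_pow]; rfl)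
  rw [Subgroup.coe_mul, Equiv.Perm.mul_apply, h.2.2, X.2.2.1, h.1]
  rfl

theorem AreReflectionsAt.mul_mul_pow (h : M.AreReflectionsAt a X Y Z) (hreg : M.IsRegular)
    {n : ℕ} (hn : (M.r1 * (M.r2 * M.r0)) ^ n = 1) : (X * Y * Z) ^ n = 1 := by
  refine hreg.pow_eq_one (a := a)
    ((commute_r1 _).mul_right ((commute_r2 _).mul_right (commute_r0 _))) ?_ (by rw [hn]; rfl)
  rw [Subgroup.coe_mul, Equiv.Perm.mul_apply, h.2.2, (X * Y).2.2.1, h.mul_apply]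
  rfl

/-- Only an embedding in `PGL(2, F)` matters, so one argument serves `PSL`, `PGL` and both
conclusions. -/
theorem AreReflectionsAt.mul_mul_pow_char_ne_one {p : ℕ} [Fact p.Prime] (hp : Odd p)
    {F : Type*} [Field F] [Finite F] [CharP F p] (hreg : M.IsRegular) (htype : M.HasType p p)
    (h : M.AreReflectionsAt a X Y Z) {ι : M.aut →* PGL(2, F)} (hι : Function.Injective ι) :
    (X * Y * Z) ^ p ≠ 1 := by
  have hne {T : M.aut} {t : Equiv.Perm Ω} (e : (T : Equiv.Perm Ω) a = t a) (ht : t a ≠ a) :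
      ι T ≠ 1 := by
    rw [map_ne_one_iff ι hι]
    rintro rfl
    exact ht e.symm
  have hX : X ^ 2 = 1 :=
    hreg.pow_eq_one (commute_r0 X) h.1 (by rw [pow_two, r0_mul_self]; rfl)
  have hY : Y ^ 2 = 1 :=
    hreg.pow_eq_one (commute_r2 Y) h.2.1 (by rw [pow_two, r2_mul_self]; rfl)
  have hZ : Z ^ 2 = 1 :=
    hreg.pow_eq_one (commute_r1 Z) h.2.2 (by rw [pow_two, r1_mul_self]; rfl)
  have hXY : (X * Y) ^ 2 = 1 :=
    hreg.pow_eq_one ((commute_r2 _).mul_right (commute_r0 _)) h.mul_apply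
      (by simp [pow_two, M.r0_r2_comm, M.r0_invol, M.r2_invol])
  have hXZ : (X * Z) ^ p = 1 := h.mul_pow_face hreg htype
  have hYZ : (Y * Z) ^ p = 1 := by
    refine hreg.pow_eq_one (a := a) ((commute_r1 _).mul_right (commute_r2 _)) ?_
      (by rw [htype.r1_mul_r2_pow]; rfl)
    rw [Subgroup.coe_mul, Equiv.Perm.mul_apply, h.2.2, Y.2.2.1, h.2.1]
    rfl
  rw [← map_ne_one_iff ι hι]
  simp only [← map_eq_one_iff ι hι, map_pow, map_mul] at hX hY hZ hXY hXZ hYZ ⊢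
  refine Matrix.ProjGenLinGroup.mul_mul_pow_char_ne_one hp hX (hne h.1 (M.r0_ne a)) hY
    (hne h.2.1 (M.r2_ne a)) hZ (hne h.2.2 (M.r1_ne a)) hXY ?_ hXZ hYZ
  rw [← map_mul]
  refine hne h.mul_apply ?_
  rw [Equiv.Perm.mul_apply, ← M.r0_r2_comm]
  exact M.r0_r2_ne a

end Reflections

end CombinatorialMap

theorem mainTheorem10 {p : ℕ} [Fact p.Prime] (hp : Odd p)
    (hyp : (1 : ℚ) / p + 1 / p < 1 / 2)
    {F : Type*} [Field F] [Finite F] [CharP F p]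
    {Ω : Type*} (M : CombinatorialMap Ω) (hreg : M.IsRegular) (htype : M.HasType p p)
    (hG : Nonempty (M.aut ≃* PSL(2, F)) ∨ Nonempty (M.aut ≃* PGL(2, F))) :
    ¬ M.IsSelfPetrieDual ∧
    ∀ (a : Ω) (X Y Z : M.aut), M.AreReflectionsAt a X Y Z →
      ∀ ι : M.aut →* PGL(2, F), Function.Injective ι →
        (ι.range = (Matrix.ProjectiveSpecialLinearGroup.toPGL (n := Fin 2) (R := F)).range ∨
          ι.range = ⊤) →
        ¬ ∃ g : PGammaL F,
          PGammaL.act g (ι Y) = ι Y ∧ PGammaL.act g (ι Z) = ι Z ∧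
          PGammaL.act g (ι X) = ι (X * Y) ∧ PGammaL.act g (ι (X * Y)) = ι X := by
  refine ⟨fun hself => ?_, ?_⟩
  · obtain ⟨a⟩ := M.nonempty
    obtain ⟨X, Y, Z, h⟩ := hreg.exists_areReflectionsAt a
    have hXYZ := h.mul_mul_pow hreg (htype.of_isIsomorphic hself).petrie_pow
    rcases hG with ⟨⟨e⟩⟩ | ⟨⟨e⟩⟩
    · exact h.mul_mul_pow_char_ne_one hp hreg htype
        (ι := Matrix.ProjectiveSpecialLinearGroup.toPGL.comp e.toMonoidHom)
        (Matrix.ProjectiveSpecialLinearGroup.toPGL_injective.comp e.injective) hXYZ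
    · exact h.mul_mul_pow_char_ne_one hp hreg htype (ι := e.toMonoidHom) e.injective hXYZ
  · rintro a X Y Z h ι hι - ⟨g, -, hgZ, hgX, -⟩
    refine h.mul_mul_pow_char_ne_one hp hreg htype hι ?_
    -- The action of `g` carries `XZ` to `XYZ`, and `(XZ)^p = 1` since faces have length `p`.
    rw [← map_eq_one_iff ι hι, map_pow, map_mul, ← hgX, ← hgZ, ← map_mul, ← map_mul, ← map_pow,
      ← map_pow, h.mul_pow_face hreg htype, map_one, map_one]
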